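/- Let $n\ge 0$ and let $\mathcal{B}(n)$ be the family of all subsets of $[n]=\{1,\dots,n\}$, ordered by inclusion. Let $\mathcal{C}\subseteq\mathcal{B}(n)$ be convex, that is, whenever $X,Y\in\mathcal{C}$ and $X\subseteq Z\subseteq Y$, then $Z\in\mathcal{C}$. Let $w(\mathcal{C})$ be the width of $\mathcal{C}$, the maximum size of an antichain contained in $\mathcal{C}$. Then $\mathcal{C}$ can be partitioned into exactly $w(\mathcal{C})$ nonempty chains each of which is skipless: whenever $Y$ is the immediate successor of $X$ in the chain, $Y$ covers $X$ in $\mathcal{C}$ (that is, no element of $\mathcal{C}$ lies strictly between $X$ and $Y$), and in fact $|Y|=|X|+1$. -/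

import Mathlib

/-- The width of a finite subset `X` of a partially ordered set: the maximum size of an
antichain contained in `X`. -/
noncomputable def width {α : Type*} [PartialOrder α] (X : Finset α) : ℕ :=
  open Classical in
  (X.powerset.filter fun A : Finset α => IsAntichain (· ≤ ·) (A : Set α)).sup Finset.card

/-- `y` covers `x` in the induced order on `X`: `x < y` are elements of `X`, and no element
of `X` other than `x` and `y` lies between them. -/
def CoversIn {α : Type*} [PartialOrder α] (X : Finset α) (x y : α) : Prop :=
  x ∈ X ∧ y ∈ X ∧ x < y ∧ ∀ z ∈ X, x ≤ z → z ≤ y → z = x ∨ z = y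

/-- A skipless chain in `X`: a chain `c ⊆ X` such that any two consecutive elements of `c`
form a cover in `X`. -/
structure IsSkiplessChain {α : Type*} [PartialOrder α] (X c : Finset α) : Prop where
  subset : c ⊆ X
  isChain : IsChain (· ≤ ·) (c : Set α)
  covers : ∀ x y : α, CoversIn c x y → CoversIn X x y

/-- An SD-partition of `X`: a partition of `X` into exactly `width X` chains (a Dilworth
partition), all of which are skipless in `X`. -/
structure IsSDPartition {α : Type*} [PartialOrder α] [DecidableEq α] (X : Finset α)
    (P : Finpartition X) : Prop where
  card_parts : P.parts.card = width X
  skipless : ∀ c ∈ P.parts, IsSkiplessChain X c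

open Finset

/-! Match elements of `C` to upper covers. If the largest deficiency `|U| - |N(U)|`, with `N` =
`upperCovers C`, is `D`, Hall's theorem gives an injective partial successor map missing at most `D`
elements, hence at most `D` chains of covers. It remains to find an antichain of size `D`. Take `U`
of largest deficiency and, among those, of largest size. Maximality matches `N(U)` into `U`
(`exists_injOn_covBy`), and counting diamonds (`card_upperCovers_sdiff_le`) shows that adding `N(U)`
to `U` does not lower the deficiency. So `N(U) ⊆ U`, and by convexity `U \ N(U)` is an antichain, of
size `D`. -/

/-- The other middle element of the diamond spanned by `u ⋖ v ⋖ z`. -/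
lemma Finset.covBy_union_sdiff_of_covBy {ι : Type*} [DecidableEq ι] {u v z : Finset ι}
    (huv : u ⋖ v) (hvz : v ⋖ z) : u ⋖ u ∪ (z \ v) ∧ u ∪ (z \ v) ⋖ z := by
  obtain ⟨y, hy, rfl⟩ := huv.exists_finset_insert
  obtain ⟨x, hx, rfl⟩ := hvz.exists_finset_insert
  simp only [mem_insert, not_or] at hx
  have h : u ∪ (insert x (insert y u) \ insert y u) = insert x u := by
    ext a
    simp only [mem_union, mem_sdiff, mem_insert]
    constructor
    · tauto
    · rintro (rfl | h)
      · exact Or.inr ⟨Or.inl rfl, by tauto⟩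
      · exact Or.inl h
  rw [h, Finset.insert_comm x y u]
  refine ⟨covBy_insert hx.2, covBy_insert ?_⟩
  simp only [mem_insert, not_or]
  exact ⟨fun h => hx.1 h.symm, hy⟩

/-- The elements of `C` that cover some element of `U`. -/
noncomputable def upperCovers {α : Type*} [PartialOrder α] (C U : Finset α) : Finset α :=
  open Classical in C.filter fun z => ∃ u ∈ U, u ⋖ z

lemma mem_upperCovers {α : Type*} [PartialOrder α] {C U : Finset α} {z : α} :
    z ∈ upperCovers C U ↔ z ∈ C ∧ ∃ u ∈ U, u ⋖ z := by
  simp [upperCovers]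

lemma upperCovers_mono {α : Type*} [PartialOrder α] {C U V : Finset α} (h : U ⊆ V) :
    upperCovers C U ⊆ upperCovers C V := by
  intro z hz
  obtain ⟨hzC, u, hu, huz⟩ := mem_upperCovers.1 hz
  exact mem_upperCovers.2 ⟨hzC, u, h hu, huz⟩

lemma upperCovers_union {α : Type*} [PartialOrder α] [DecidableEq α] (C U V : Finset α) :
    upperCovers C (U ∪ V) = upperCovers C U ∪ upperCovers C V := by
  ext z
  simp only [mem_upperCovers, mem_union, or_and_right, exists_or, and_or_left]

/-- If the upper covers `V` of `U` can be matched into `U` along covers, then every subset of `V`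
has at most the deficiency of `V`. -/
lemma card_upperCovers_sdiff_le {ι : Type*} [DecidableEq ι] {C U W : Finset (Finset ι)}
    (hC : Set.OrdConnected (C : Set (Finset ι))) (hU : U ⊆ C)
    (m : Finset ι → Finset ι) (hm : Set.InjOn m (upperCovers C U))
    (hmU : ∀ v ∈ upperCovers C U, m v ∈ U ∧ m v ⋖ v) :
    (upperCovers C (upperCovers C U) \ upperCovers C W).card ≤ (upperCovers C U \ W).card := by
  classical
  set V := upperCovers C U
  have hVC : V ⊆ C := fun v hv => (mem_upperCovers.1 hv).1
  set S := upperCovers C V \ upperCovers C W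
  have hSC : ∀ z ∈ S, z ∈ C := fun z hz => (mem_upperCovers.1 (mem_sdiff.1 hz).1).1
  have hdiamond : ∀ u ∈ U, ∀ v z, u ⋖ v → v ⋖ z → z ∈ C → u ∪ (z \ v) ∈ V := by
    intro u hu v z huv hvz hz
    obtain ⟨h1, h2⟩ := covBy_union_sdiff_of_covBy huv hvz
    exact mem_upperCovers.2 ⟨hC.out (hU hu) hz ⟨h1.le, h2.le⟩, u, hu, h1⟩
  -- Each `z ∈ S` splits a unit weight evenly over its lower covers `v ∈ V`; the share of `v` goes
  -- to the other middle `φ (z, v)` of the diamond from `m v` to `z`.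
  let deg : Finset ι → ℕ := fun z => (V.filter (· ⋖ z)).card
  let P := (S ×ˢ V).filter fun p => p.2 ⋖ p.1
  let φ : Finset ι × Finset ι → Finset ι := fun p => m p.2 ∪ (p.1 \ p.2)
  have hP : ∀ p ∈ P, p.1 ∈ S ∧ p.2 ∈ V ∧ p.2 ⋖ p.1 := by
    intro p hp
    obtain ⟨h, h'⟩ := mem_filter.1 hp
    exact ⟨(mem_product.1 h).1, (mem_product.1 h).2, h'⟩
  have hφcov : ∀ p ∈ P, m p.2 ⋖ φ p ∧ φ p ⋖ p.1 := fun p hp =>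
    covBy_union_sdiff_of_covBy (hmU _ (hP p hp).2.1).2 (hP p hp).2.2
  have hφ : ∀ p ∈ P, φ p ∈ V \ W := by
    intro p hp
    obtain ⟨h1, h2, h3⟩ := hP p hp
    refine mem_sdiff.2 ⟨hdiamond _ (hmU _ h2).1 _ _ (hmU _ h2).2 h3 (hSC _ h1), fun hW => ?_⟩
    exact (mem_sdiff.1 h1).2 (mem_upperCovers.2 ⟨hSC _ h1, _, hW, (hφcov p hp).2⟩)
  have hsum : ∑ p ∈ P, (1 / deg p.1 : ℚ) = S.card := by
    rw [sum_filter, sum_product, card_eq_sum_ones, Nat.cast_sum]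
    refine sum_congr rfl fun z hz => ?_
    rw [← sum_filter]
    change ∑ _v ∈ V.filter (· ⋖ z), (1 / deg z : ℚ) = _
    rw [sum_const, nsmul_eq_mul, Nat.cast_one]
    refine mul_one_div_cancel ?_
    obtain ⟨v, hv, hvz⟩ := (mem_upperCovers.1 (mem_sdiff.1 hz).1).2
    exact_mod_cast (card_pos.2 ⟨v, mem_filter.2 ⟨hv, hvz⟩⟩).ne'
  -- With `K` the lower covers of `v` in `U`, at most `|K|` shares reach `v`, each at most `1 /
  -- |K|`.
  have hfib : ∀ v ∈ V \ W, ∑ p ∈ P with φ p = v, (1 / deg p.1 : ℚ) ≤ 1 := by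
    intro v hv
    set K := U.filter (· ⋖ v)
    have hKpos : (0 : ℚ) < K.card := by
      obtain ⟨u, hu, huv⟩ := (mem_upperCovers.1 (mem_sdiff.1 hv).1).2
      exact_mod_cast card_pos.2 ⟨u, mem_filter.2 ⟨hu, huv⟩⟩
    have hdeg : ∀ p ∈ P.filter (φ · = v), K.card ≤ deg p.1 := by
      intro p hp
      obtain ⟨hpP, rfl⟩ := mem_filter.1 hp
      refine card_le_card_of_injOn (fun u => u ∪ (p.1 \ φ p)) ?_ ?_
      · intro u hu
        obtain ⟨huU, huv⟩ := mem_filter.1 hu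
        exact mem_filter.2 ⟨hdiamond u huU _ _ huv (hφcov p hpP).2 (hSC _ (hP p hpP).1),
          (covBy_union_sdiff_of_covBy huv (hφcov p hpP).2).2⟩
      · intro u hu u' hu' h
        have key : ∀ a ∈ K, (a ∪ (p.1 \ φ p)) ∩ φ p = a := by
          intro a ha
          rw [union_inter_distrib_right, sdiff_inter_self, union_empty]
          exact inter_eq_left.2 (mem_filter.1 ha).2.le
        rw [← key u hu, ← key u' hu']
        exact congrArg (· ∩ φ p) h
    have hcard : (P.filter (φ · = v)).card ≤ K.card := by
      refine card_le_card_of_injOn (fun p => m p.2) ?_ ?_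
      · intro p hp
        obtain ⟨hpP, rfl⟩ := mem_filter.1 hp
        exact mem_filter.2 ⟨(hmU _ (hP p hpP).2.1).1, (hφcov p hpP).1⟩
      · intro p hp q hq h
        obtain ⟨hp, hpv⟩ := mem_filter.1 hp
        obtain ⟨hq, hqv⟩ := mem_filter.1 hq
        have h2 : p.2 = q.2 := hm (hP p hp).2.1 (hP q hq).2.1 h
        have key : ∀ r ∈ P, φ r ∪ r.2 = r.1 := by
          intro r hr
          obtain ⟨-, hr2, hr3⟩ := hP r hr
          change m r.2 ∪ (r.1 \ r.2) ∪ r.2 = r.1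
          rw [union_assoc, sdiff_union_of_subset hr3.le]
          exact union_eq_right.2 ((hmU _ hr2).2.le.trans hr3.le)
        refine Prod.ext ?_ h2
        rw [← key p hp, ← key q hq, hpv, hqv, h2]
    calc ∑ p ∈ P with φ p = v, (1 / deg p.1 : ℚ)
        ≤ ∑ p ∈ P with φ p = v, (1 / K.card : ℚ) := by
          refine sum_le_sum fun p hp => one_div_le_one_div_of_le hKpos ?_
          exact_mod_cast hdeg p hp
      _ = (P.filter (φ · = v)).card * (1 / K.card : ℚ) := by rw [sum_const, nsmul_eq_mul]
      _ ≤ K.card * (1 / K.card : ℚ) := by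
          refine mul_le_mul_of_nonneg_right ?_ (by positivity)
          exact_mod_cast hcard
      _ = 1 := mul_one_div_cancel hKpos.ne'
  have : (S.card : ℚ) ≤ (V \ W).card := by
    rw [← hsum, ← sum_fiberwise_of_maps_to hφ, card_eq_sum_ones, Nat.cast_sum]
    exact sum_le_sum fun v hv => by simpa using hfib v hv
  exact_mod_cast this

/-- If `U` has the largest deficiency in `C`, its upper covers can be matched into it. -/
lemma exists_injOn_covBy {α : Type*} [PartialOrder α] [DecidableEq α] {C U : Finset α}
    (hU : U ⊆ C)
    (hmax : ∀ U' ⊆ C, U'.card + (upperCovers C U).card ≤ U.card + (upperCovers C U').card) :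
    ∃ m : α → α, Set.InjOn m (upperCovers C U) ∧ ∀ v ∈ upperCovers C U, m v ∈ U ∧ m v ⋖ v := by
  classical
  set V := upperCovers C U
  obtain ⟨f, hf, hfm⟩ := (all_card_le_biUnion_card_iff_exists_injective
    (fun v : V => U.filter (· ⋖ v.1))).1 (by
      intro s
      set B := s.biUnion fun v : V => U.filter (· ⋖ v.1)
      have hBU : B ⊆ U := biUnion_subset.2 fun v _ => filter_subset _ _
      -- Removing `B` from `U` removes all of `s` from the upper covers, so `|B| < |s|` would
      -- increase the deficiency.
      have h1 := hmax (U \ B) (sdiff_subset.trans hU)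
      have h2 : upperCovers C (U \ B) ⊆ V \ s.map (.subtype _) := by
        intro z hz
        refine mem_sdiff.2 ⟨upperCovers_mono sdiff_subset hz, fun hzs => ?_⟩
        obtain ⟨v, hv, rfl⟩ := mem_map.1 hzs
        obtain ⟨-, u, hu, huz⟩ := mem_upperCovers.1 hz
        obtain ⟨huU, huB⟩ := mem_sdiff.1 hu
        exact huB (mem_biUnion.2 ⟨v, hv, mem_filter.2 ⟨huU, huz⟩⟩)
      have h3 := card_le_card h2
      have hsV : s.map (.subtype _) ⊆ V := by
        intro z hz
        obtain ⟨v, -, rfl⟩ := mem_map.1 hz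
        exact v.2
      have h4 := card_sdiff_add_card_eq_card hsV
      have h5 := card_sdiff_add_card_eq_card hBU
      rw [card_map] at h4
      omega)
  refine ⟨fun v => if h : v ∈ V then f ⟨v, h⟩ else v, ?_, ?_⟩
  · intro v hv w hw h
    have hv' : v ∈ V := hv
    have hw' : w ∈ V := hw
    simp only [hv', hw', dif_pos] at h
    exact congrArg Subtype.val (hf h)
  · intro v hv
    simp only [hv, dif_pos]
    exact mem_filter.1 (hfm ⟨v, hv⟩)

/-- Hall's theorem with deficiency `D`, for the cover relation on `C`. -/
lemma exists_injective_sum_fin {α : Type*} [PartialOrder α] {C : Finset α} {D : ℕ}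
    (h : ∀ U ⊆ C, U.card ≤ (upperCovers C U).card + D) :
    ∃ F : C → C ⊕ Fin D, Function.Injective F ∧ ∀ x y, F x = .inl y → x.1 ⋖ y.1 := by
  classical
  obtain ⟨F, hF, hFm⟩ := (all_card_le_biUnion_card_iff_exists_injective
    (fun x : C => (univ.filter fun y : C => x.1 ⋖ y.1).disjSum (univ : Finset (Fin D)))).1 (by
      intro s
      -- The `D` dummy targets are adjacent to every element, so any nonempty `s` sees them all.
      rcases s.eq_empty_or_nonempty with rfl | ⟨a, ha⟩
      · simp
      have h1 := h (s.map (.subtype _)) (by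
        intro z hz
        obtain ⟨v, -, rfl⟩ := mem_map.1 hz
        exact v.2)
      rw [card_map] at h1
      refine h1.trans ?_
      set T := upperCovers C (s.map (.subtype _))
      have hTC : ∀ z ∈ T, z ∈ C := fun z hz => (mem_upperCovers.1 hz).1
      have : (T.subtype (· ∈ C)).card = T.card := by
        rw [card_subtype, filter_true_of_mem hTC]
      rw [← this]
      conv_lhs => rw [← Fintype.card_fin D, ← card_univ, ← card_disjSum]
      refine card_le_card fun w hw => mem_biUnion.2 ?_
      rcases mem_disjSum.1 hw with ⟨y, hy, rfl⟩ | ⟨i, -, rfl⟩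
      · obtain ⟨-, u, hu, huy⟩ := mem_upperCovers.1 (mem_subtype.1 hy)
        obtain ⟨x, hx, rfl⟩ := mem_map.1 hu
        exact ⟨x, hx, inl_mem_disjSum.2 (mem_filter.2 ⟨mem_univ _, huy⟩)⟩
      · exact ⟨a, ha, inr_mem_disjSum.2 (mem_univ _)⟩)
  refine ⟨F, hF, fun x y hxy => ?_⟩
  have := hFm x
  rw [hxy] at this
  exact (mem_filter.1 (inl_mem_disjSum.1 this)).2

/-- Following a partial injection along covers splits `C` into chains of covers, one for each
element with no successor. -/
lemma exists_finpartition_of_injective {α : Type*} [PartialOrder α] [DecidableEq α]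
    {C : Finset α} {D : ℕ} {F : C → C ⊕ Fin D} (hF : Function.Injective F)
    (hcov : ∀ x y, F x = .inl y → x.1 ⋖ y.1) :
    ∃ P : Finpartition C, P.parts.card ≤ D ∧ ∀ c ∈ P.parts,
      IsChain (· ≤ ·) (c : Set α) ∧ ∀ x y, CoversIn c x y → x ⋖ y := by
  classical
  let r : C → C → Prop := fun x y => F x = .inl y
  have hr : Relator.RightUnique r := fun x y z hy hz => Sum.inl_injective (hy.symm.trans hz)
  have hr' : Relator.RightUnique (Function.swap r) := fun x y z hy hz => hF (hy.trans hz.symm)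
  have hle : ∀ x y, Relation.ReflTransGen r x y → x ≤ y := by
    intro x y h
    induction h with
    | refl => exact le_rfl
    | tail _ h ih => exact ih.trans (hcov _ _ h).le
  have hend : ∀ x : C, ∃ i, ∃ z, Relation.ReflTransGen r x z ∧ F z = .inr i := by
    intro x
    induction x using WellFoundedGT.induction with
    | ind x ih =>
      rcases hx : F x with y | i
      · obtain ⟨i, z, hz, hzi⟩ := ih y (hcov x y hx).lt
        exact ⟨i, z, .head hx hz, hzi⟩
      · exact ⟨i, x, .refl, hx⟩
  -- The label of `x` is the dummy at which its successor path stops; injectivity of `F` makes each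
  -- label class a single path.
  choose lab top htop hlab using hend
  have hterm : ∀ {z w : C} {i}, F z = .inr i → Relation.ReflTransGen r z w → z = w := by
    intro z w i hz h
    rcases h.cases_head with h | ⟨y, hy, -⟩
    · exact h
    · exact absurd (hz.symm.trans hy) (by simp)
  have hstep : ∀ x y, r x y → lab x = lab y := by
    intro x y hxy
    have heq : top x = top y := by
      rcases Relation.ReflTransGen.total_of_right_unique hr (htop x) (.head hxy (htop y)) with h | h
      · exact hterm (hlab x) h
      · exact (hterm (hlab y) h).symm
    exact Sum.inr_injective ((hlab x).symm.trans ((congrArg F heq).trans (hlab y)))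
  have htotal : ∀ x y, lab x = lab y → Relation.ReflTransGen r x y ∨ Relation.ReflTransGen r y x := by
    intro x y h
    have heq : top x = top y := hF ((hlab x).trans ((congrArg Sum.inr h).trans (hlab y).symm))
    have hx := Relation.reflTransGen_swap.2 (htop x)
    have hy := Relation.reflTransGen_swap.2 (heq ▸ htop y)
    rcases Relation.ReflTransGen.total_of_right_unique hr' hx hy with h | h
    · exact .inr (Relation.reflTransGen_swap.1 h)
    · exact .inl (Relation.reflTransGen_swap.1 h)
  let fib : Fin D → Finset α := fun i => (univ.filter (lab · = i)).map (.subtype _)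
  have hfib : ∀ x i, x ∈ fib i ↔ ∃ h : x ∈ C, lab ⟨x, h⟩ = i := by
    intro x i
    simp [fib]
  -- Unused dummies give empty fibres, which are discarded.
  refine ⟨Finpartition.ofExistsUnique ((univ.image fib).erase ∅) ?_ ?_ (notMem_erase _ _),
    ?_, ?_⟩
  · intro p hp
    obtain ⟨i, -, rfl⟩ := mem_image.1 (mem_of_mem_erase hp)
    exact fun x hx => ((hfib x i).1 hx).1
  · intro a ha
    have hmem : a ∈ fib (lab ⟨a, ha⟩) := (hfib _ _).2 ⟨ha, rfl⟩
    refine ⟨fib (lab ⟨a, ha⟩), ⟨mem_erase.2 ⟨ne_empty_of_mem hmem,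
      mem_image_of_mem _ (mem_univ _)⟩, hmem⟩, ?_⟩
    rintro t ⟨ht, hat⟩
    obtain ⟨i, -, rfl⟩ := mem_image.1 (mem_of_mem_erase ht)
    obtain ⟨_, rfl⟩ := (hfib _ _).1 hat
    rfl
  · calc ((univ.image fib).erase ∅).card ≤ (univ.image fib).card := card_erase_le
      _ ≤ (univ : Finset (Fin D)).card := card_image_le
      _ = D := by simp
  · intro c hc
    obtain ⟨i, -, rfl⟩ := mem_image.1 (mem_of_mem_erase hc)
    constructor
    · intro x hx y hy _
      obtain ⟨hxC, hxi⟩ := (hfib _ _).1 hx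
      obtain ⟨hyC, hyi⟩ := (hfib _ _).1 hy
      exact (htotal ⟨x, hxC⟩ ⟨y, hyC⟩ (hxi.trans hyi.symm)).imp (hle _ _) (hle _ _)
    · rintro x y ⟨hx, hy, hlt, hbetween⟩
      obtain ⟨hxC, hxi⟩ := (hfib _ _).1 hx
      obtain ⟨hyC, hyi⟩ := (hfib _ _).1 hy
      rcases htotal ⟨x, hxC⟩ ⟨y, hyC⟩ (hxi.trans hyi.symm) with h | h
      · rcases h.cases_head with h | ⟨z, hxz, hzy⟩
        · exact absurd (congrArg Subtype.val h) hlt.ne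
        · have hz : z.1 ∈ fib i := (hfib _ _).2 ⟨z.2, (hstep _ _ hxz).symm.trans hxi⟩
          have hxz' := hcov _ _ hxz
          rcases hbetween z.1 hz hxz'.le (hle _ _ hzy) with h | h
          · exact absurd h hxz'.lt.ne'
          · exact h ▸ hxz'
      · exact absurd (hle _ _ h) hlt.not_ge

lemma card_le_width {α : Type*} [PartialOrder α] {X A : Finset α} (hA : A ⊆ X)
    (h : IsAntichain (· ≤ ·) (A : Set α)) : A.card ≤ width X := by
  classical
  exact le_sup (f := Finset.card) (mem_filter.2 ⟨mem_powerset.2 hA, h⟩)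

lemma width_le_card_parts {α : Type*} [PartialOrder α] [DecidableEq α] {X : Finset α}
    (P : Finpartition X) (h : ∀ c ∈ P.parts, IsChain (· ≤ ·) (c : Set α)) :
    width X ≤ P.parts.card := by
  classical
  refine Finset.sup_le fun A hA => ?_
  obtain ⟨hAX, hA⟩ := mem_filter.1 hA
  rw [mem_powerset] at hAX
  refine card_le_card_of_injOn P.part (fun a ha => P.part_mem.2 (hAX ha)) ?_
  intro a ha b hb hab
  have haX := hAX ha
  have hbX := hAX hb
  by_contra hne
  have ha' : a ∈ P.part a := P.mem_part_self.2 haX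
  have hb' : b ∈ P.part a := hab ▸ P.mem_part_self.2 hbX
  rcases h _ (P.part_mem.2 haX) ha' hb' hne with hle | hle
  · exact hA ha hb hne hle
  · exact hA hb ha (Ne.symm hne) hle

/-- The deficiency of the cover relation on a convex family of sets is attained by an antichain. -/
lemma exists_isAntichain_forall_card_le {ι : Type*} {C : Finset (Finset ι)}
    (hC : Set.OrdConnected (C : Set (Finset ι))) :
    ∃ A ⊆ C, IsAntichain (· ≤ ·) (A : Set (Finset ι)) ∧
      ∀ U ⊆ C, U.card ≤ (upperCovers C U).card + A.card := by
  classical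
  let N := upperCovers C
  obtain ⟨U₀, hU₀, hmax₀⟩ := exists_max_image C.powerset
    (fun U => (U.card : ℤ) - (N U).card) ⟨∅, empty_mem_powerset C⟩
  obtain ⟨U, hU, hUmax⟩ := exists_max_image
    (C.powerset.filter fun U => (U.card : ℤ) - (N U).card = (U₀.card : ℤ) - (N U₀).card)
    Finset.card ⟨U₀, mem_filter.2 ⟨hU₀, rfl⟩⟩
  obtain ⟨hUC, hUd⟩ := mem_filter.1 hU
  rw [mem_powerset] at hUC
  have hmax : ∀ U' ⊆ C, U'.card + (N U).card ≤ U.card + (N U').card := by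
    intro U' hU'
    have := hmax₀ U' (mem_powerset.2 hU')
    omega
  obtain ⟨m, hm, hmU⟩ := exists_injOn_covBy hUC hmax
  have hNC : N U ⊆ C := fun v hv => (mem_upperCovers.1 hv).1
  have hNU : N U ⊆ U := by
    -- Taking `W = U ∩ N U` bounds the upper covers gained by `U ∪ N U` by the number of elements
    -- gained.
    have h1 : (N (N U) \ N (U ∩ N U)).card ≤ (N U \ (U ∩ N U)).card :=
      card_upperCovers_sdiff_le hC hUC m hm hmU
    have h2 : N (U ∪ N U) ⊆ N U ∪ (N (N U) \ N (U ∩ N U)) := by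
      intro z hz
      simp only [N, upperCovers_union, mem_union] at hz
      simp only [mem_union, mem_sdiff]
      rcases hz with hz | hz
      · exact .inl hz
      · by_cases h : z ∈ N (U ∩ N U)
        · exact .inl (upperCovers_mono inter_subset_left h)
        · exact .inr ⟨hz, h⟩
    have h3 := (card_le_card h2).trans (card_union_le _ _)
    have h4 : (U ∪ N U).card = U.card + (N U \ (U ∩ N U)).card := by
      rw [← union_sdiff_self_eq_union, card_union_of_disjoint disjoint_sdiff, inter_comm,
        sdiff_inter_self_left]
    have h5 := hmax (U ∪ N U) (union_subset hUC hNC)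
    have h6 := hUmax (U ∪ N U) (mem_filter.2 ⟨mem_powerset.2 (union_subset hUC hNC), by omega⟩)
    exact union_eq_left.1 (eq_of_subset_of_card_le subset_union_left h6).symm
  refine ⟨U \ N U, sdiff_subset.trans hUC, ?_, ?_⟩
  -- Climb from `X` to `Y` one element at a time: convexity keeps the path in `C`, and `N U ⊆ U`
  -- keeps it in `U`.
  · have key : ∀ Y ∈ C, ∀ k, ∀ X ∈ U, X ⊂ Y → (Y \ X).card = k → Y ∈ N U := by
      intro Y hY k
      induction k with
      | zero =>
        intro X _ hXY hk
        exact absurd (sdiff_eq_empty_iff_subset.1 (card_eq_zero.1 hk)) hXY.2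
      | succ k ih =>
        intro X hX hXY hk
        obtain ⟨a, haY, haX⟩ := exists_of_ssubset hXY
        have hsub : insert a X ⊆ Y := insert_subset haY hXY.1
        have hcov := covBy_insert haX
        have hZ : insert a X ∈ N U :=
          mem_upperCovers.2 ⟨hC.out (hUC hX) hY ⟨hcov.le, hsub⟩, X, hX, hcov⟩
        rcases eq_or_ssubset_of_subset hsub with h | h
        · exact h ▸ hZ
        · refine ih _ (hNU hZ) h ?_
          rw [sdiff_insert, card_erase_of_mem (mem_sdiff.2 ⟨haY, haX⟩), hk]
          rfl
    intro X hX Y hY hne hle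
    obtain ⟨hXU, -⟩ := mem_sdiff.1 hX
    obtain ⟨hYU, hYN⟩ := mem_sdiff.1 hY
    exact hYN (key Y (hUC hYU) _ X hXU (lt_of_le_of_ne hle hne) rfl)
  · intro U' hU'
    have h1 := hmax U' hU'
    have h2 := card_sdiff_add_card_eq_card hNU
    change U'.card ≤ (N U').card + _
    omega

/-- Every convex family of subsets of an `n`-element set has an SD-partition; in it, consecutive
elements of a chain differ in size by exactly one. -/
theorem theorem10 (n : ℕ) (C : Finset (Finset (Fin n)))
    (hC : Set.OrdConnected (C : Set (Finset (Fin n)))) :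
    ∃ P : Finpartition C, IsSDPartition C P ∧
      ∀ c ∈ P.parts, ∀ x y : Finset (Fin n), CoversIn c x y → y.card = x.card + 1 := by
  obtain ⟨A, hAC, hA, hdef⟩ := exists_isAntichain_forall_card_le hC
  obtain ⟨F, hF, hcov⟩ := exists_injective_sum_fin hdef
  obtain ⟨P, hPcard, hP⟩ := exists_finpartition_of_injective hF hcov
  refine ⟨P, ⟨?_, fun c hc => ⟨P.le hc, (hP c hc).1, fun x y hxy => ?_⟩⟩, fun c hc x y hxy => ?_⟩
  -- The antichain `A` bounds the number of chains above by the width; distinct elements of an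
  -- antichain lie in distinct chains, which gives the converse.
  · exact (hPcard.trans (card_le_width hAC hA)).antisymm
      (width_le_card_parts P fun c hc => (hP c hc).1)
  · have h := (hP c hc).2 x y hxy
    exact ⟨P.le hc hxy.1, P.le hc hxy.2.1, h.lt, fun z _ hxz hzy =>
      h.wcovBy.eq_or_eq hxz hzy⟩
  · exact (Nat.covBy_iff_add_one_eq.1 ((hP c hc).2 x y hxy).card_finset).symm
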